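/- Let $n\ge 0$ and $m>n^2$ be integers. Let $\operatorname{Sing}_{n,m}$ be the set of all $m$-tuples $(A_1,\dots,A_m)$ of complex $n\times n$ matrices such that $\sum_{k=1}^m\lambda_kA_k$ is singular for all $\lambda\in\mathbb{Q}^m$, and let $I(\operatorname{Sing}_{n,m})\subseteq\mathbb{C}[X^{(1)},\dots,X^{(m)}]$ be its vanishing ideal, where $X^{(k)}=(x^{(k)}_{ij})_{1\le i,j\le n}$ are matrices of independent variables. View $\mathbb{C}[X^{(1)},\dots,X^{(m')}]$ as a subring of $\mathbb{C}[X^{(1)},\dots,X^{(m)}]$ for $m'\le m$. Let $G=\operatorname{GL}_m(\mathbb{C})\times\operatorname{GL}_n(\mathbb{C})\times\operatorname{GL}_n(\mathbb{C})$ act on $\mathbb{C}[X^{(1)},\dots,X^{(m)}]=\bigoplus_d S^d(\mathbb{C}^m\otimes\mathbb{C}^n\otimes\mathbb{C}^n)$ by algebra automorphisms, where the variable $x^{(k)}_{ij}$ is identified with $e_k\otimes e_i\otimes e_j$ and $(U,V,W)$ sends it to $Ue_k\otimes Ve_i\otimes We_j$. Let $H$ be either $G$ or its factor $\operatorname{GL}_m(\mathbb{C})$.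 A highest weight vector for $H$ is a nonzero vector on which the diagonal torus of $H$ acts through an integral weight and which is fixed by all elements of $H$ that are upper triangular with ones on the diagonal (in each factor). Then every irreducible $H$-subrepresentation $V$ of $\mathbb{C}[X^{(1)},\dots,X^{(m)}]$ contained in $I(\operatorname{Sing}_{n,m})$ contains a highest weight vector for $H$, and every highest weight vector $f\in V$ lies in $I(\operatorname{Sing}_{n,n^2})$; in particular $f$ involves only the variables of $X^{(1)},\dots,X^{(n^2)}$. -/

import Mathlib

open Matrix

/-- Index set of the variables `x_{ij}^{(k)}`, ordered as `(k, i, j)`; equivalently, of the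
coordinates on `ℂ^m ⊗ ℂ^n ⊗ ℂ^n`. -/
abbrev TensorIndex (m n : ℕ) : Type := Fin m × Fin n × Fin n

/-- The polynomial ring `ℂ[X^{(1)}, …, X^{(m)}]` in `m` generic `n × n` matrices. -/
abbrev TensorPoly (m n : ℕ) : Type := MvPolynomial (TensorIndex m n) ℂ

/-- The `k`-th matrix of the matrix tuple given by the coordinates `A`. -/
def slice {m n : ℕ} (A : TensorIndex m n → ℂ) (k : Fin m) : Matrix (Fin n) (Fin n) ℂ :=
  Matrix.of fun i j => A (k, i, j)

/-- The variety `Sing_{n,m}`: all `m`-tuples of complex `n × n` matrices all of whose rational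
linear combinations are singular. -/
def Sing (n m : ℕ) : Set (TensorIndex m n → ℂ) :=
  {A | ∀ c : Fin m → ℚ, (∑ k, (c k : ℂ) • slice A k).det = 0}

/-- The vanishing ideal `I(Sing_{n,m})` in `ℂ[X^{(1)}, …, X^{(m)}]`. -/
noncomputable def singIdeal (n m : ℕ) : Ideal (TensorPoly m n) :=
  MvPolynomial.vanishingIdeal ℂ (Sing n m)

/-- The group `GL_m × GL_n × GL_n`. -/
abbrev TensorGroup (m n : ℕ) : Type := GL (Fin m) ℂ × GL (Fin n) ℂ × GL (Fin n) ℂ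

/-- The linear substitution by which `g = (U, V, W)` acts on polynomials: the variable
`x_{ij}^{(k)}`, seen as the basis vector `e_k ⊗ e_i ⊗ e_j` of `ℂ^m ⊗ ℂ^n ⊗ ℂ^n`, is sent to
`(U e_k) ⊗ (V e_i) ⊗ (W e_j)`. -/
noncomputable def tensorSubst {m n : ℕ} (g : TensorGroup m n) :
    TensorPoly m n →ₐ[ℂ] TensorPoly m n :=
  MvPolynomial.aeval fun p : TensorIndex m n =>
    ∑ q : TensorIndex m n,
      MvPolynomial.C (g.1.1 q.1 p.1 * g.2.1.1 q.2.1 p.2.1 * g.2.2.1 q.2.2 p.2.2) *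
        MvPolynomial.X q

lemma tensorSubst_X {m n : ℕ} (g : TensorGroup m n) (p : TensorIndex m n) :
    tensorSubst g (MvPolynomial.X p) = ∑ q : TensorIndex m n,
      MvPolynomial.C (g.1.1 q.1 p.1 * g.2.1.1 q.2.1 p.2.1 * g.2.2.1 q.2.2 p.2.2) *
        MvPolynomial.X q := by
  simp [tensorSubst]

lemma tensorSubst_one {m n : ℕ} :
    tensorSubst (1 : TensorGroup m n) = AlgHom.id ℂ (TensorPoly m n) := by
  apply MvPolynomial.algHom_ext
  intro p
  rw [tensorSubst_X, Finset.sum_eq_single p]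
  · simp
  · rintro ⟨k, i, j⟩ - hq
    obtain ⟨k', i', j'⟩ := p
    by_cases h1 : k = k' <;> by_cases h2 : i = i' <;> by_cases h3 : j = j' <;>
      simp_all
  · simp

lemma tensorSubst_mul {m n : ℕ} (g h : TensorGroup m n) :
    tensorSubst (g * h) = (tensorSubst g).comp (tensorSubst h) := by
  apply MvPolynomial.algHom_ext
  intro p
  simp only [AlgHom.comp_apply, tensorSubst_X, map_sum, map_mul, MvPolynomial.algHom_C,
    MvPolynomial.algebraMap_eq, Finset.mul_sum]
  rw [Finset.sum_comm]
  refine Finset.sum_congr rfl fun r _ => ?_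
  simp only [← mul_assoc, ← map_mul, ← Finset.sum_mul, ← map_sum]
  congr 2
  have key : ∀ (a : Fin m → ℂ) (b c : Fin n → ℂ),
      (∑ x, a x) * (∑ y, b y) * (∑ z, c z) =
        ∑ s : TensorIndex m n, a s.1 * b s.2.1 * c s.2.2 := by
    intro a b c
    simp only [Fintype.sum_prod_type, Finset.sum_mul, Finset.mul_sum]
    rw [Finset.sum_comm]
    refine (Finset.sum_congr rfl fun x _ => Finset.sum_comm).trans ?_
    rw [Finset.sum_comm]
  simp only [Prod.fst_mul, Prod.snd_mul, Units.val_mul, Matrix.mul_apply, key]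
  refine Finset.sum_congr rfl fun s _ => ?_
  ring

/-- The representation of `GL_m × GL_n × GL_n` on
`ℂ[X^{(1)}, …, X^{(m)}] = ⨁_d S^d(ℂ^m ⊗ ℂ^n ⊗ ℂ^n)`. -/
noncomputable def tensorRep (m n : ℕ) : Representation ℂ (TensorGroup m n) (TensorPoly m n) where
  toFun g := (tensorSubst g).toLinearMap
  map_one' := by rw [tensorSubst_one]; rfl
  map_mul' g h := by rw [tensorSubst_mul]; rfl

/-- The restriction of `tensorRep` to the factor `GL_m`. -/
noncomputable def tensorRepGLm (m n : ℕ) : Representation ℂ (GL (Fin m) ℂ) (TensorPoly m n) :=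
  (tensorRep m n).comp (MonoidHom.inl (GL (Fin m) ℂ) (GL (Fin n) ℂ × GL (Fin n) ℂ))

/-- The element of the maximal torus of `GL_r` with diagonal entries `t`. -/
def torusElem {r : ℕ} (t : Fin r → ℂˣ) : GL (Fin r) ℂ where
  val := Matrix.diagonal fun i => (t i : ℂ)
  inv := Matrix.diagonal fun i => ((t i)⁻¹ : ℂˣ)
  val_inv := by simp [Matrix.diagonal_mul_diagonal]
  inv_val := by simp [Matrix.diagonal_mul_diagonal]

/-- The character `t ↦ ∏ i, t_i ^ w_i` of the maximal torus of `GL_r`. -/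
def torusChar {r : ℕ} (w : Fin r → ℤ) (t : Fin r → ℂˣ) : ℂˣ := ∏ i, t i ^ w i

/-- `u` lies in the maximal unipotent subgroup: it is upper triangular with ones on the
diagonal. -/
def IsUpperUnipotent {r : ℕ} (u : GL (Fin r) ℂ) : Prop :=
  (∀ i j, j < i → u.1 i j = 0) ∧ ∀ i, u.1 i i = 1

/-- `f` is a highest weight vector of weight `w` for `GL_r` (with respect to the upper triangular
Borel subgroup): a nonzero weight vector of weight `w` that is fixed by the maximal unipotent
subgroup. -/
structure IsHighestWeightVector {r : ℕ} {M : Type*} [AddCommGroup M] [Module ℂ M]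
    (ρ : Representation ℂ (GL (Fin r) ℂ) M) (w : Fin r → ℤ) (f : M) : Prop where
  ne_zero : f ≠ 0
  weight : ∀ t : Fin r → ℂˣ, ρ (torusElem t) f = (torusChar w t : ℂ) • f
  unipotent : ∀ u : GL (Fin r) ℂ, IsUpperUnipotent u → ρ u f = f

/-- `f` is a highest weight vector of weight `(w₁, w₂, w₃)` for `GL_m × GL_n × GL_n` (with respect
to the product of the upper triangular Borel subgroups). -/
structure IsTensorHighestWeightVector {m n : ℕ} {M : Type*} [AddCommGroup M] [Module ℂ M]
    (ρ : Representation ℂ (TensorGroup m n) M) (w₁ : Fin m → ℤ) (w₂ w₃ : Fin n → ℤ) (f : M) :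
    Prop where
  ne_zero : f ≠ 0
  weight : ∀ (t₁ : Fin m → ℂˣ) (t₂ t₃ : Fin n → ℂˣ),
    ρ (torusElem t₁, torusElem t₂, torusElem t₃) f =
      ((torusChar w₁ t₁ * torusChar w₂ t₂ * torusChar w₃ t₃ : ℂˣ) : ℂ) • f
  unipotent : ∀ (u₁ : GL (Fin m) ℂ) (u₂ u₃ : GL (Fin n) ℂ),
    IsUpperUnipotent u₁ → IsUpperUnipotent u₂ → IsUpperUnipotent u₃ → ρ (u₁, u₂, u₃) f = f

/-- The inclusion `ℂ[X^{(1)}, …, X^{(m')}] ↪ ℂ[X^{(1)}, …, X^{(m)}]` for `m' ≤ m`. -/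
noncomputable def tensorIncl (n : ℕ) {m' m : ℕ} (h : m' ≤ m) :
    TensorPoly m' n →ₐ[ℂ] TensorPoly m n :=
  MvPolynomial.rename fun p => (Fin.castLE h p.1, p.2)

/-! Give the variable x_{ij}^{(k)} the weight k+i+j. An upper unipotent element changes a polynomial
only by terms of lower weight (`algHom_sub_self_mem_weightLT`). So if f in V has the least possible
top weight among nonzero elements of V, then u·f - f lies in V with smaller top weight and must
vanish. Among such f, one with the fewest monomials is a torus weight vector: otherwise a scaling of
f minus a multiple of f would be nonzero with fewer monomials. Irreducibility supplies V ≠ 0.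

For the restriction, let f be fixed by the upper unipotent subgroup of GL_m. At a point whose first
n² matrices form a basis of the matrix space, such an element clears all later matrices, so f takes
the same value there as after setting those matrices to zero. Such points are the nonvanishing locus
of `frameDet`, so this is a polynomial identity. Extending by zero maps Sing_{n,n²} into Sing_{n,m},
so the restricted polynomial stays in the ideal. -/

section Scaling

/-! ### Scalings, weight filtrations and minimal elements. -/

variable {σ : Type*}

/-- The algebra endomorphism that multiplies each variable `X p` by the scalar `c p`. -/
noncomputable def scaleVars (c : σ → ℂ) : MvPolynomial σ ℂ →ₐ[ℂ] MvPolynomial σ ℂ :=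
  MvPolynomial.aeval fun p => MvPolynomial.C (c p) * MvPolynomial.X p

lemma coeff_scaleVars [Fintype σ] (c : σ → ℂ) (s : σ →₀ ℕ) (f : MvPolynomial σ ℂ) :
    (scaleVars c f).coeff s = (∏ p, c p ^ s p) * f.coeff s := by
  classical
  induction f using MvPolynomial.induction_on' with
  | monomial u a =>
    have : scaleVars c (MvPolynomial.monomial u a) =
        MvPolynomial.monomial u (a * ∏ p, c p ^ u p) := by
      rw [scaleVars, MvPolynomial.aeval_monomial, Finsupp.prod_fintype _ _ (by simp)]
      simp only [mul_pow, Finset.prod_mul_distrib, MvPolynomial.algebraMap_eq]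
      rw [MvPolynomial.monomial_eq, Finsupp.prod_fintype _ _ (by simp)]
      simp [mul_assoc]
    rw [this, MvPolynomial.coeff_monomial, MvPolynomial.coeff_monomial]
    split_ifs with h
    · subst h; ring
    · simp
  | add p q hp hq => rw [map_add, MvPolynomial.coeff_add, MvPolynomial.coeff_add, hp, hq, mul_add]

/-- Distinct degrees give distinct powers of 2, so this one scaling separates the graded pieces. -/
lemma prod_two_pow_pow [Fintype σ] (φ : σ → ℕ) (s : σ →₀ ℕ) :
    ∏ p, ((2 : ℂ) ^ φ p) ^ s p = 2 ^ Finsupp.weight φ s := by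
  simp only [Finsupp.weight_eq_sum, ← pow_mul, Finset.prod_pow_eq_pow_sum, smul_eq_mul, mul_comm]

lemma prod_comp_pow [Fintype σ] {r : ℕ} (π : σ → Fin r) (t : Fin r → ℂ) (s : σ →₀ ℕ) :
    ∏ p, t (π p) ^ s p =
      ∏ k, t k ^ Finsupp.weight (fun p => if π p = k then 1 else 0) s := by
  simp only [Finsupp.weight_eq_sum, ← Finset.prod_pow_eq_pow_sum]
  rw [Finset.prod_comm]
  refine Finset.prod_congr rfl fun p _ => ?_
  rw [Finset.prod_eq_single (π p)]
  · simp
  · intro k _ hk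
    simp [hk.symm]
  · simp

/-- The polynomials all of whose monomials have `ℓ`-weight less than `L`. -/
noncomputable def weightLT (ℓ : σ → ℕ) (L : ℕ) : Submodule ℂ (MvPolynomial σ ℂ) :=
  MvPolynomial.restrictSupport ℂ {s | Finsupp.weight ℓ s < L}

lemma weightLT_mono (ℓ : σ → ℕ) {K L : ℕ} (h : K ≤ L) : weightLT ℓ K ≤ weightLT ℓ L :=
  MvPolynomial.restrictSupport_mono _ fun _ hs => lt_of_lt_of_le hs h

/-- Both bounds are strict, so the weights of a product add up to at most K + L - 2; this is the
source of the slack of one. -/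
lemma mul_mem_weightLT {ℓ : σ → ℕ} {K L N : ℕ} (hN : K + L ≤ N + 1) {f g : MvPolynomial σ ℂ}
    (hf : f ∈ weightLT ℓ K) (hg : g ∈ weightLT ℓ L) : f * g ∈ weightLT ℓ N := by
  have h := Submodule.mul_mem_mul hf hg
  rw [weightLT, weightLT, ← MvPolynomial.restrictSupport_add] at h
  refine MvPolynomial.restrictSupport_mono _ ?_ h
  rintro _ ⟨a, ha, b, hb, rfl⟩
  simp only [Set.mem_ofPred_eq, map_add] at ha hb ⊢
  omega

lemma exists_mem_weightLT (ℓ : σ → ℕ) (f : MvPolynomial σ ℂ) : ∃ L, f ∈ weightLT ℓ L := by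
  refine ⟨f.support.sup (Finsupp.weight ℓ) + 1, ?_⟩
  intro s hs
  exact Nat.lt_succ_of_le (Finset.le_sup (f := Finsupp.weight ℓ) hs)

/-- A substitution that changes every variable only by terms of lower weight changes every
polynomial only by terms of lower weight. -/
lemma algHom_sub_self_mem_weightLT {ℓ : σ → ℕ} (T : MvPolynomial σ ℂ →ₐ[ℂ] MvPolynomial σ ℂ)
    (hT : ∀ p, T (MvPolynomial.X p) - MvPolynomial.X p ∈ weightLT ℓ (ℓ p)) {L : ℕ}
    {f : MvPolynomial σ ℂ} (hf : f ∈ weightLT ℓ (L + 1)) : T f - f ∈ weightLT ℓ L := by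
  -- Lowering the weight of the error passes to products, so it suffices to know it on variables.
  have hmul : ∀ (K M : ℕ) (g h : MvPolynomial σ ℂ), g ∈ weightLT ℓ (K + 1) →
      h ∈ weightLT ℓ (M + 1) → T g - g ∈ weightLT ℓ K → T h - h ∈ weightLT ℓ M →
      T (g * h) - g * h ∈ weightLT ℓ (K + M) := by
    intro K M g h hg hh hg' hh'
    have hTh : T h ∈ weightLT ℓ (M + 1) := by
      rw [← sub_add_cancel (T h) h]
      exact Submodule.add_mem _ (weightLT_mono ℓ M.le_succ hh') hh
    rw [map_mul, show T g * T h - g * h = (T g - g) * T h + g * (T h - h) by ring]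
    exact Submodule.add_mem _ (mul_mem_weightLT (by omega) hg' hTh)
      (mul_mem_weightLT (by omega) hg hh')
  have hmem : ∀ (s : σ →₀ ℕ) (a : ℂ),
      MvPolynomial.monomial s a ∈ weightLT ℓ (Finsupp.weight ℓ s + 1) := by
    intro s a
    rw [weightLT, MvPolynomial.monomial_mem_restrictSupport]
    exact Or.inl (Nat.lt_succ_self _)
  have hC : ∀ a : ℂ, T (MvPolynomial.C a) - MvPolynomial.C a = 0 := fun a => by
    rw [← MvPolynomial.algebraMap_eq, T.commutes, sub_self]
  have hmono : ∀ (s : σ →₀ ℕ) (a : ℂ),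
      T (MvPolynomial.monomial s a) - MvPolynomial.monomial s a ∈
        weightLT ℓ (Finsupp.weight ℓ s) := by
    intro s
    induction s using Finsupp.induction_linear with
    | zero =>
      intro a
      rw [← MvPolynomial.C_apply, hC]
      exact Submodule.zero_mem _
    | add s t hs ht =>
      intro a
      have h := hmul _ _ _ _ (hmem s a) (hmem t 1) (hs a) (ht 1)
      rwa [MvPolynomial.monomial_mul, mul_one, ← map_add] at h
    | single p e =>
      induction e with
      | zero =>
        intro a
        rw [Finsupp.single_zero, ← MvPolynomial.C_apply, hC]
        exact Submodule.zero_mem _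
      | succ e ih =>
        intro a
        have hX : T (MvPolynomial.monomial (Finsupp.single p 1) 1) -
            MvPolynomial.monomial (Finsupp.single p 1) 1 ∈
              weightLT ℓ (Finsupp.weight ℓ (Finsupp.single p 1)) := by
          rw [Finsupp.weight_single, one_smul]
          exact hT p
        have h := hmul _ _ _ _ (hmem _ a) (hmem _ 1) (ih a) hX
        rwa [MvPolynomial.monomial_mul, mul_one, ← map_add, ← Finsupp.single_add] at h
  rw [f.as_sum, map_sum, ← Finset.sum_sub_distrib]
  refine Submodule.sum_mem _ fun s hs => ?_
  exact weightLT_mono ℓ (Nat.lt_succ_iff.mp (hf hs)) (hmono s _)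

/-- A nonzero subspace that is stable under the scalings `X p ↦ 2 ^ φ i p • X p` contains a nonzero
polynomial that is homogeneous with respect to all the gradings `φ i`, and whose `ℓ`-weight is
minimal in the subspace. -/
lemma exists_homogeneous_of_scaleVars_mem [Fintype σ] {ι : Type*} (φ : ι → σ → ℕ) (ℓ : σ → ℕ)
    (V : Submodule ℂ (MvPolynomial σ ℂ)) (hV : V ≠ ⊥)
    (hφ : ∀ i, ∀ f ∈ V, scaleVars (fun p => (2 : ℂ) ^ φ i p) f ∈ V) :
    ∃ f ∈ V, f ≠ 0 ∧
      (∃ a : ι → ℕ, ∀ i, ∀ s ∈ f.support, Finsupp.weight (φ i) s = a i) ∧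
      ∃ L, f ∈ weightLT ℓ (L + 1) ∧ ∀ g ∈ V, g ∈ weightLT ℓ L → g = 0 := by
  classical
  obtain ⟨f₀, hf₀, hf₀0⟩ := V.exists_mem_ne_zero_of_ne_bot hV
  have hex : ∃ L, ∃ f ∈ V, f ≠ 0 ∧ f ∈ weightLT ℓ (L + 1) := by
    obtain ⟨L, hL⟩ := exists_mem_weightLT ℓ f₀
    exact ⟨L, f₀, hf₀, hf₀0, weightLT_mono ℓ L.le_succ hL⟩
  -- Second minimisation: fewest monomials among the elements of least top weight.
  have hex' : ∃ c, ∃ f ∈ V, f ≠ 0 ∧ f ∈ weightLT ℓ (Nat.find hex + 1) ∧ f.support.card = c := by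
    obtain ⟨f, h1, h2, h3⟩ := Nat.find_spec hex
    exact ⟨_, f, h1, h2, h3, rfl⟩
  obtain ⟨f, hfV, hf0, hfL, hfc⟩ := Nat.find_spec hex'
  obtain ⟨s₀, hs₀⟩ := MvPolynomial.support_nonempty.mpr hf0
  refine ⟨f, hfV, hf0, ⟨fun i => Finsupp.weight (φ i) s₀, fun i s hs => ?_⟩,
    Nat.find hex, hfL, fun g hgV hgL => ?_⟩
  -- The coefficient of g at s₀ cancels, so g has fewer monomials than f and must be zero; then
  -- every monomial of f has the same φ i-degree as s₀.
  · set g := scaleVars (fun p => (2 : ℂ) ^ φ i p) f - (2 : ℂ) ^ Finsupp.weight (φ i) s₀ • f with hg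
    have hcoeff : ∀ u, g.coeff u =
        ((2 : ℂ) ^ Finsupp.weight (φ i) u - 2 ^ Finsupp.weight (φ i) s₀) * f.coeff u := by
      intro u
      rw [hg, MvPolynomial.coeff_sub, coeff_scaleVars, prod_two_pow_pow, MvPolynomial.coeff_smul,
        smul_eq_mul, sub_mul]
    have hsub : g.support ⊆ f.support.erase s₀ := by
      intro u hu
      rw [MvPolynomial.mem_support_iff, hcoeff] at hu
      rw [Finset.mem_erase, MvPolynomial.mem_support_iff]
      refine ⟨?_, right_ne_zero_of_mul hu⟩
      rintro rfl
      simp at hu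
    have hg0 : g = 0 := by
      by_contra hne
      have hlt : g.support.card < Nat.find hex' := by
        rw [← hfc]
        exact (Finset.card_le_card hsub).trans_lt (Finset.card_erase_lt_of_mem hs₀)
      exact Nat.find_min hex' hlt ⟨g, V.sub_mem (hφ i f hfV) (V.smul_mem _ hfV), hne,
        fun u hu => hfL (Finset.erase_subset _ _ (hsub hu)), rfl⟩
    have h := hcoeff s
    rw [hg0, MvPolynomial.coeff_zero] at h
    have h2 := sub_eq_zero.mp
      ((mul_eq_zero.mp h.symm).resolve_right (MvPolynomial.mem_support_iff.mp hs))
    exact Nat.pow_right_injective le_rfl (by exact_mod_cast h2)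
  · by_contra hg0
    rcases h : Nat.find hex with _ | L
    · rw [h] at hgL
      obtain ⟨u, hu⟩ := MvPolynomial.support_nonempty.mpr hg0
      exact Nat.not_lt_zero _ (hgL hu)
    · exact Nat.find_min hex (m := L) (by omega) ⟨g, hgV, hg0, h ▸ hgL⟩

end Scaling

/-! ### Torus and unipotent elements acting on variables. -/

section TensorAction

variable {m n : ℕ}

/-- The weight of the variable `x_{ij}^{(k)}` is `k + i + j`. -/
def indexSum (p : TensorIndex m n) : ℕ := p.1 + p.2.1 + p.2.2

lemma tensorSubst_torusElem (t₁ : Fin m → ℂˣ) (t₂ t₃ : Fin n → ℂˣ) :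
    tensorSubst (torusElem t₁, torusElem t₂, torusElem t₃) =
      scaleVars fun p : TensorIndex m n => (t₁ p.1 : ℂ) * t₂ p.2.1 * t₃ p.2.2 := by
  apply MvPolynomial.algHom_ext
  intro p
  rw [tensorSubst_X, scaleVars, MvPolynomial.aeval_X, Finset.sum_eq_single p]
  · simp [torusElem]
  · rintro ⟨k, i, j⟩ - hq
    obtain ⟨k', i', j'⟩ := p
    by_cases h1 : k = k' <;> by_cases h2 : i = i' <;> by_cases h3 : j = j' <;>
      simp_all [torusElem]
  · simp

/-- Triangularity leaves only variables whose three indices are at most the original ones; all but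
the original, which has coefficient 1, have smaller index sum. -/
lemma tensorSubst_sub_self_mem_weightLT {u₁ : GL (Fin m) ℂ} {u₂ u₃ : GL (Fin n) ℂ}
    (h₁ : IsUpperUnipotent u₁) (h₂ : IsUpperUnipotent u₂) (h₃ : IsUpperUnipotent u₃) {L : ℕ}
    {f : TensorPoly m n} (hf : f ∈ weightLT indexSum (L + 1)) :
    tensorSubst (u₁, u₂, u₃) f - f ∈ weightLT indexSum L := by
  refine algHom_sub_self_mem_weightLT _ (fun p => ?_) hf
  rw [tensorSubst_X, ← Finset.sum_erase_add _ _ (Finset.mem_univ p)]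
  simp only [h₁.2, h₂.2, h₃.2, mul_one, map_one, one_mul, add_sub_cancel_right]
  refine Submodule.sum_mem _ fun q hq => ?_
  by_cases hle : q.1 ≤ p.1 ∧ q.2.1 ≤ p.2.1 ∧ q.2.2 ≤ p.2.2
  · have hlt : indexSum q < indexSum p := by
      have hne := Finset.ne_of_mem_erase hq
      obtain ⟨k, i, j⟩ := p
      obtain ⟨k', i', j'⟩ := q
      simp only [indexSum, ne_eq, Prod.mk.injEq, Fin.ext_iff, Fin.le_def] at hle hne ⊢
      omega
    rw [MvPolynomial.C_mul_X_eq_monomial, weightLT, MvPolynomial.monomial_mem_restrictSupport]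
    left
    simpa [Finsupp.weight_single] using hlt
  · have h0 : u₁.1 q.1 p.1 * u₂.1 q.2.1 p.2.1 * u₃.1 q.2.2 p.2.2 = 0 := by
      simp only [not_and_or, not_le] at hle
      rcases hle with h | h | h
      · rw [h₁.1 _ _ h]; ring
      · rw [h₂.1 _ _ h]; ring
      · rw [h₃.1 _ _ h]; ring
    simp [h0]

lemma isUpperUnipotent_one {r : ℕ} : IsUpperUnipotent (1 : GL (Fin r) ℂ) :=
  ⟨fun i j h => by simp [Matrix.one_apply_ne h.ne'], fun i => by simp⟩

lemma torusElem_one {r : ℕ} : torusElem (1 : Fin r → ℂˣ) = 1 := by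
  ext i j
  simp [torusElem]

lemma coe_torusChar_natCast {r : ℕ} (a : Fin r → ℕ) (t : Fin r → ℂˣ) :
    (torusChar (fun k => (a k : ℤ)) t : ℂ) = ∏ k, (t k : ℂ) ^ a k := by
  simp [torusChar]

end TensorAction

/-! ### Existence of highest weight vectors. -/

section HighestWeight

variable {m n : ℕ}

/-- The gradings of the polynomial ring by the three indices of the variables. -/
def indexGrading : Fin m ⊕ Fin n ⊕ Fin n → TensorIndex m n → ℕ
  | .inl k => fun p => if p.1 = k then 1 else 0
  | .inr (.inl i) => fun p => if p.2.1 = i then 1 else 0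
  | .inr (.inr j) => fun p => if p.2.2 = j then 1 else 0

/-- The torus element that has the entry `2` in position `k` and `1` elsewhere. -/
noncomputable def twoAt {r : ℕ} (k : Fin r) : Fin r → ℂˣ := fun i =>
  Units.mk0 (2 : ℂ) two_ne_zero ^ (if i = k then 1 else 0 : ℕ)

lemma tensorSubst_twoAt_fst (k : Fin m) :
    tensorSubst (torusElem (twoAt k), 1, 1) =
      scaleVars fun p : TensorIndex m n => (2 : ℂ) ^ indexGrading (.inl k) p := by
  rw [← torusElem_one, tensorSubst_torusElem]
  simp only [twoAt, indexGrading, Units.val_pow_eq_pow_val, Units.val_mk0, Pi.one_apply,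
    Units.val_one, mul_one]

lemma tensorSubst_twoAt_snd (i : Fin n) :
    tensorSubst (1, torusElem (twoAt i), 1) =
      scaleVars fun p : TensorIndex m n => (2 : ℂ) ^ indexGrading (.inr (.inl i)) p := by
  rw [← torusElem_one, ← torusElem_one, tensorSubst_torusElem]
  simp only [twoAt, indexGrading, Units.val_pow_eq_pow_val, Units.val_mk0, Pi.one_apply,
    Units.val_one, mul_one, one_mul]

lemma tensorSubst_twoAt_thd (j : Fin n) :
    tensorSubst (1, 1, torusElem (twoAt j)) =
      scaleVars fun p : TensorIndex m n => (2 : ℂ) ^ indexGrading (.inr (.inr j)) p := by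
  rw [← torusElem_one, ← torusElem_one, tensorSubst_torusElem]
  simp only [twoAt, indexGrading, Units.val_pow_eq_pow_val, Units.val_mk0, Pi.one_apply,
    Units.val_one, mul_one, one_mul]

lemma scaleVars_eq_smul {σ : Type*} [Fintype σ] {c : σ → ℂ} {x : ℂ} {f : MvPolynomial σ ℂ}
    (h : ∀ s ∈ f.support, ∏ p, c p ^ s p = x) : scaleVars c f = x • f := by
  ext s
  rw [coeff_scaleVars, MvPolynomial.coeff_smul, smul_eq_mul]
  by_cases hs : s ∈ f.support
  · rw [h s hs]
  · rw [MvPolynomial.notMem_support_iff.mp hs, mul_zero, mul_zero]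

theorem exists_isTensorHighestWeightVector (V : Subrepresentation (tensorRep m n))
    (hV : V.toSubmodule ≠ ⊥) :
    ∃ f ∈ V, ∃ w₁ w₂ w₃, IsTensorHighestWeightVector (tensorRep m n) w₁ w₂ w₃ f := by
  obtain ⟨f, hfV, hf0, ⟨a, ha⟩, L, hfL, hmin⟩ :=
    exists_homogeneous_of_scaleVars_mem indexGrading indexSum V.toSubmodule hV (by
      rintro (k | i | j) f hf
      · rw [← tensorSubst_twoAt_fst]
        exact V.apply_mem_toSubmodule _ hf
      · rw [← tensorSubst_twoAt_snd]
        exact V.apply_mem_toSubmodule _ hf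
      · rw [← tensorSubst_twoAt_thd]
        exact V.apply_mem_toSubmodule _ hf)
  refine ⟨f, hfV, fun k => (a (.inl k) : ℤ), fun i => (a (.inr (.inl i)) : ℤ),
    fun j => (a (.inr (.inr j)) : ℤ), hf0, fun t₁ t₂ t₃ => ?_, fun u₁ u₂ u₃ h₁ h₂ h₃ => ?_⟩
  · change tensorSubst _ f = _
    rw [tensorSubst_torusElem]
    refine scaleVars_eq_smul fun s hs => ?_
    have hprod : ∀ {r : ℕ} (π : TensorIndex m n → Fin r) (t : Fin r → ℂˣ) (b : Fin r → ℕ),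
        (∀ k, Finsupp.weight (fun p => if π p = k then 1 else 0) s = b k) →
        ∏ p, (t (π p) : ℂ) ^ s p = torusChar (fun k => (b k : ℤ)) t := by
      intro r π t b hb
      rw [prod_comp_pow π (fun k => (t k : ℂ)), coe_torusChar_natCast]
      exact Finset.prod_congr rfl fun k _ => by rw [hb k]
    simp only [mul_pow, Finset.prod_mul_distrib, Units.val_mul]
    rw [hprod (fun p => p.1) t₁ (fun k => a (.inl k)) fun k => ha (.inl k) s hs,
      hprod (fun p => p.2.1) t₂ (fun i => a (.inr (.inl i))) fun i => ha (.inr (.inl i)) s hs,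
      hprod (fun p => p.2.2) t₃ (fun j => a (.inr (.inr j))) fun j => ha (.inr (.inr j)) s hs]
  · exact sub_eq_zero.mp (hmin _
      (V.toSubmodule.sub_mem (V.apply_mem_toSubmodule (u₁, u₂, u₃) hfV) hfV)
      (tensorSubst_sub_self_mem_weightLT h₁ h₂ h₃ hfL))

theorem exists_isHighestWeightVector (V : Subrepresentation (tensorRepGLm m n))
    (hV : V.toSubmodule ≠ ⊥) : ∃ f ∈ V, ∃ w, IsHighestWeightVector (tensorRepGLm m n) w f := by
  obtain ⟨f, hfV, hf0, ⟨a, ha⟩, L, hfL, hmin⟩ :=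
    exists_homogeneous_of_scaleVars_mem (fun k => indexGrading (.inl k)) indexSum V.toSubmodule hV
      (by
        intro k f hf
        rw [← tensorSubst_twoAt_fst]
        exact V.apply_mem_toSubmodule _ hf)
  refine ⟨f, hfV, fun k => (a k : ℤ), hf0, fun t => ?_, fun u hu => ?_⟩
  · change tensorSubst (torusElem t, 1, 1) f = _
    rw [← torusElem_one, tensorSubst_torusElem]
    refine scaleVars_eq_smul fun s hs => ?_
    simp only [Pi.one_apply, Units.val_one, mul_one]
    rw [prod_comp_pow (fun p : TensorIndex m n => p.1) (fun k => (t k : ℂ)),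
      coe_torusChar_natCast]
    exact Finset.prod_congr rfl fun k _ => congrArg _ (ha k s hs)
  · exact sub_eq_zero.mp (hmin _
      (V.toSubmodule.sub_mem (V.apply_mem_toSubmodule u hfV) hfV)
      (tensorSubst_sub_self_mem_weightLT hu isUpperUnipotent_one isUpperUnipotent_one hfL))

/-- Irreducibility includes two distinct subrepresentations, which the zero space lacks. -/
lemma toSubmodule_ne_bot_of_isIrreducible {G M : Type*} [Monoid G] [AddCommGroup M] [Module ℂ M]
    {ρ : Representation ℂ G M} (V : Subrepresentation ρ) (hV : V.toRepresentation.IsIrreducible) :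
    V.toSubmodule ≠ ⊥ := by
  intro h
  obtain ⟨W₁, W₂, hne⟩ := hV.exists_pair_ne
  have : Subsingleton V.toSubmodule := (Submodule.subsingleton_iff_eq_bot).mpr h
  exact hne (Subrepresentation.toSubmodule_injective (Subsingleton.elim _ _))

end HighestWeight

/-! ### Unipotent invariants involve only the first n² matrices. -/

section Restriction

variable {m n : ℕ}

/-- The position of the pair `b` of matrix indices among the first `n ^ 2` matrices. -/
def pairIndex (hm : n ^ 2 ≤ m) (b : Fin n × Fin n) : Fin m :=
  Fin.castLE (by rwa [← sq]) (finProdFinEquiv b)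

lemma pairIndex_val_lt (hm : n ^ 2 ≤ m) (b : Fin n × Fin n) :
    (pairIndex hm b : ℕ) < n ^ 2 := by
  rw [sq]
  exact (finProdFinEquiv b).isLt

lemma pairIndex_injective (hm : n ^ 2 ≤ m) : Function.Injective (pairIndex hm) :=
  (Fin.castLE_injective _).comp finProdFinEquiv.injective

/-- The determinant of the `n ^ 2 × n ^ 2` matrix whose rows are the first `n ^ 2` matrices. -/
noncomputable def frameDet (hm : n ^ 2 ≤ m) : TensorPoly m n :=
  (Matrix.of fun b q : Fin n × Fin n => (MvPolynomial.X (pairIndex hm b, q) : TensorPoly m n)).det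

lemma eval_frameDet (hm : n ^ 2 ≤ m) (A : TensorIndex m n → ℂ) :
    MvPolynomial.eval A (frameDet hm) =
      (Matrix.of fun b q : Fin n × Fin n => A (pairIndex hm b, q)).det := by
  rw [frameDet, RingHom.map_det]
  congr 1
  ext b q
  simp

/-- At the tuple of matrix units the frame is the identity matrix. -/
lemma frameDet_ne_zero (hm : n ^ 2 ≤ m) : frameDet hm ≠ 0 := by
  intro h
  have h1 := eval_frameDet hm fun p : TensorIndex m n => if p.1 = pairIndex hm p.2 then 1 else 0
  have h2 : (Matrix.of fun b q : Fin n × Fin n =>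
      if pairIndex hm b = pairIndex hm q then (1 : ℂ) else 0) = 1 := by
    ext b q
    simp [Matrix.one_apply, (pairIndex_injective hm).eq_iff]
  simp only [h, map_zero, h2, Matrix.det_one] at h1
  exact zero_ne_one h1

/-- The upper triangular matrix with ones on the diagonal that subtracts from the `k`-th basis
vector, for `N ≤ k`, the combination with coefficients `c q k` of the basis vectors `q < N`. -/
def eliminator (N : ℕ) (c : Fin m → Fin m → ℂ) : Matrix (Fin m) (Fin m) ℂ :=
  Matrix.of fun q k => if (q : ℕ) < N ∧ N ≤ (k : ℕ) then c q k else 0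

/-- An intermediate index would have to be both below N and at least N. Square zero makes 1 + E the
inverse of 1 - E. -/
lemma eliminator_mul_self (N : ℕ) (c : Fin m → Fin m → ℂ) :
    eliminator N c * eliminator N c = 0 := by
  ext q k
  rw [Matrix.mul_apply]
  refine Finset.sum_eq_zero fun r _ => ?_
  simp only [eliminator, Matrix.of_apply]
  split_ifs with h1 h2
  · omega
  all_goals simp

/-- The unipotent element `1 - eliminator N c`. -/
def eliminatorUnit (N : ℕ) (c : Fin m → Fin m → ℂ) : GL (Fin m) ℂ where
  val := 1 - eliminator N c
  inv := 1 + eliminator N c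
  val_inv := by simp [sub_mul, mul_add, eliminator_mul_self]
  inv_val := by simp [mul_sub, add_mul, eliminator_mul_self]

lemma isUpperUnipotent_eliminatorUnit (N : ℕ) (c : Fin m → Fin m → ℂ) :
    IsUpperUnipotent (eliminatorUnit N c) := by
  refine ⟨fun i j h => ?_, fun i => ?_⟩
  · have h1 : ¬((i : ℕ) < N ∧ N ≤ (j : ℕ)) := by omega
    simp [eliminatorUnit, eliminator, h1, Matrix.one_apply_ne h.ne']
  · have h1 : ¬((i : ℕ) < N ∧ N ≤ (i : ℕ)) := by omega
    simp [eliminatorUnit, eliminator, h1]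

/-- Moves the group action from the polynomial to the point, where it recombines the matrices of the
tuple. -/
lemma eval_tensorSubst_fst (u : GL (Fin m) ℂ) (A : TensorIndex m n → ℂ) (f : TensorPoly m n) :
    MvPolynomial.eval A (tensorSubst (u, 1, 1) f) =
      MvPolynomial.eval (fun p => ∑ k, u.1 k p.1 * A (k, p.2)) f := by
  have h : (MvPolynomial.aeval A).comp (tensorSubst (u, 1, 1)) =
      (MvPolynomial.aeval fun p => ∑ k, u.1 k p.1 * A (k, p.2) : TensorPoly m n →ₐ[ℂ] ℂ) := by
    apply MvPolynomial.algHom_ext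
    rintro ⟨k, q⟩
    rw [AlgHom.comp_apply, tensorSubst_X, map_sum, MvPolynomial.aeval_X, Fintype.sum_prod_type]
    refine Finset.sum_congr rfl fun r _ => ?_
    rw [Finset.sum_eq_single q]
    · simp
    · rintro ⟨i, j⟩ - hq
      obtain ⟨i', j'⟩ := q
      by_cases h2 : i = i' <;> by_cases h3 : j = j' <;> simp_all
    · simp
  exact DFunLike.congr_fun h f

/-- Setting the matrices `X^{(k)}` with `n ^ 2 ≤ k` to zero. -/
noncomputable def restrictVars (n m : ℕ) : TensorPoly m n →ₐ[ℂ] TensorPoly (n ^ 2) n :=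
  MvPolynomial.aeval fun p =>
    if h : (p.1 : ℕ) < n ^ 2 then MvPolynomial.X (⟨p.1, h⟩, p.2) else 0

/-- Extending a matrix tuple by zero. -/
def extendZero (m : ℕ) (B : TensorIndex (n ^ 2) n → ℂ) (p : TensorIndex m n) : ℂ :=
  if h : (p.1 : ℕ) < n ^ 2 then B (⟨p.1, h⟩, p.2) else 0

lemma eval_restrictVars (B : TensorIndex (n ^ 2) n → ℂ) (f : TensorPoly m n) :
    MvPolynomial.eval B (restrictVars n m f) = MvPolynomial.eval (extendZero m B) f := by
  have h : (MvPolynomial.aeval B).comp (restrictVars n m) =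
      (MvPolynomial.aeval (extendZero m B) : TensorPoly m n →ₐ[ℂ] ℂ) := by
    apply MvPolynomial.algHom_ext
    intro p
    rw [AlgHom.comp_apply, restrictVars, MvPolynomial.aeval_X, MvPolynomial.aeval_X, extendZero]
    split_ifs <;> simp
  exact DFunLike.congr_fun h f

lemma extendZero_mem_Sing (hm : n ^ 2 ≤ m) {B : TensorIndex (n ^ 2) n → ℂ}
    (hB : B ∈ Sing n (n ^ 2)) : extendZero m B ∈ Sing n m := by
  intro c
  rw [← hB fun k => c (Fin.castLE hm k)]
  congr 1
  refine (Fintype.sum_of_injective (Fin.castLE hm) (Fin.castLE_injective hm) _ _ ?_ ?_).symm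
  · intro k hk
    have hk' : ¬(k : ℕ) < n ^ 2 := fun h => hk ⟨⟨k, h⟩, rfl⟩
    ext i j
    simp [slice, extendZero, hk']
  · intro k
    ext i j
    simp [slice, extendZero]

lemma restrictVars_mem_singIdeal (hm : n ^ 2 ≤ m) {f : TensorPoly m n} (hf : f ∈ singIdeal n m) :
    restrictVars n m f ∈ singIdeal n (n ^ 2) := by
  rw [singIdeal, MvPolynomial.mem_vanishingIdeal_iff] at hf ⊢
  intro B hB
  have h := hf _ (extendZero_mem_Sing hm hB)
  rwa [MvPolynomial.aeval_eq_eval, ← eval_restrictVars] at h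

/-- A polynomial that is fixed by the upper unipotent subgroup of `GL_m` involves only the first
`n ^ 2` matrices: at a point whose first `n ^ 2` matrices form a basis, the other matrices can be
moved to zero. -/
theorem tensorIncl_restrictVars_eq_self (hm : n ^ 2 ≤ m) {f : TensorPoly m n}
    (hf : ∀ u : GL (Fin m) ℂ, IsUpperUnipotent u → tensorSubst (u, 1, 1) f = f) :
    tensorIncl n hm (restrictVars n m f) = f := by
  -- After multiplying by `frameDet` the identity is checked pointwise; points with a degenerate
  -- frame become trivial.
  refine mul_left_cancel₀ (frameDet_ne_zero hm) (MvPolynomial.funext fun A => ?_)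
  rw [map_mul, map_mul, eval_frameDet]
  set M : Matrix (Fin n × Fin n) (Fin n × Fin n) ℂ :=
    Matrix.of fun b q => A (pairIndex hm b, q) with hM
  rcases eq_or_ne M.det 0 with h0 | h0
  · rw [h0, zero_mul, zero_mul]
  congr 1
  -- Coordinates of the k-th matrix in the basis given by the first n² matrices.
  let x : Fin m → Fin n × Fin n → ℂ := fun k => (fun q => A (k, q)) ᵥ* M⁻¹
  have hx : ∀ k q, ∑ b, x k b * A (pairIndex hm b, q) = A (k, q) := by
    intro k q
    have h : x k ᵥ* M = fun q => A (k, q) := by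
      rw [Matrix.vecMul_vecMul, Matrix.nonsing_inv_mul _ (isUnit_iff_ne_zero.mpr h0),
        Matrix.vecMul_one]
    exact congrFun h q
  -- The sum over b places the coordinate x k b in row `pairIndex hm b`.
  let u := eliminatorUnit (n ^ 2) fun q k => ∑ b, if pairIndex hm b = q then x k b else 0
  have hu : (fun p : TensorIndex m n => ∑ k, u.1 k p.1 * A (k, p.2)) =
      extendZero m fun q => A (Fin.castLE hm q.1, q.2) := by
    funext ⟨k, q⟩
    -- The eliminator reproduces each later matrix from the basis, so subtracting it sends that
    -- matrix to zero, and it leaves the first n² alone.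
    have hsum : ∑ r, eliminator (n ^ 2)
        (fun q k => ∑ b, if pairIndex hm b = q then x k b else 0) r k * A (r, q) =
          if n ^ 2 ≤ (k : ℕ) then A (k, q) else 0 := by
      split_ifs with hk
      · have hr : ∀ r, eliminator (n ^ 2)
            (fun q k => ∑ b, if pairIndex hm b = q then x k b else 0) r k * A (r, q) =
              ∑ b, if pairIndex hm b = r then x k b * A (r, q) else 0 := by
          intro r
          by_cases hr : (r : ℕ) < n ^ 2
          · simp [eliminator, hk, hr, Finset.sum_mul, ite_mul]
          · rw [Finset.sum_eq_zero]
            · simp [eliminator, hr]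
            · rintro b -
              rw [if_neg]
              rintro rfl
              exact hr (pairIndex_val_lt hm b)
        rw [Finset.sum_congr rfl fun r _ => hr r, Finset.sum_comm, ← hx k q]
        simp
      · simp [eliminator, hk]
    simp only [u, eliminatorUnit, Matrix.sub_apply, sub_mul, Finset.sum_sub_distrib, hsum,
      Matrix.one_apply, ite_mul, one_mul, zero_mul, Finset.sum_ite_eq', Finset.mem_univ, if_true,
      extendZero]
    by_cases hk : (k : ℕ) < n ^ 2
    · simp [hk, not_le.mpr hk]
    · simp [hk, not_lt.mp hk]
  have hA := congrArg (MvPolynomial.eval A) (hf u (isUpperUnipotent_eliminatorUnit _ _))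
  rw [eval_tensorSubst_fst, hu, ← eval_restrictVars] at hA
  rw [← hA, tensorIncl, MvPolynomial.eval_rename]
  rfl

lemma vars_tensorIncl_lt (hm : n ^ 2 ≤ m) (h : TensorPoly (n ^ 2) n) :
    ∀ p ∈ (tensorIncl n hm h).vars, (p.1 : ℕ) < n ^ 2 := by
  classical
  intro p hp
  obtain ⟨q, -, rfl⟩ := Finset.mem_image.mp (MvPolynomial.vars_rename _ _ hp)
  exact q.1.isLt

end Restriction

theorem theorem4p4 (n m : ℕ) (hm : n ^ 2 < m) :
    -- irreducible subrepresentations for `GL_m × GL_n × GL_n`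
    (∀ V : Subrepresentation (tensorRep m n),
      V.toRepresentation.IsIrreducible →
      (∀ f ∈ V, f ∈ singIdeal n m) →
      (∃ f ∈ V, ∃ w₁ w₂ w₃, IsTensorHighestWeightVector (tensorRep m n) w₁ w₂ w₃ f) ∧
      ∀ f ∈ V, ∀ w₁ w₂ w₃, IsTensorHighestWeightVector (tensorRep m n) w₁ w₂ w₃ f →
        (∃ h ∈ singIdeal n (n ^ 2), tensorIncl n hm.le h = f) ∧
        ∀ p ∈ f.vars, (p.1 : ℕ) < n ^ 2) ∧
    -- irreducible subrepresentations for `GL_m`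
    (∀ V : Subrepresentation (tensorRepGLm m n),
      V.toRepresentation.IsIrreducible →
      (∀ f ∈ V, f ∈ singIdeal n m) →
      (∃ f ∈ V, ∃ w, IsHighestWeightVector (tensorRepGLm m n) w f) ∧
      ∀ f ∈ V, ∀ w, IsHighestWeightVector (tensorRepGLm m n) w f →
        (∃ h ∈ singIdeal n (n ^ 2), tensorIncl n hm.le h = f) ∧
        ∀ p ∈ f.vars, (p.1 : ℕ) < n ^ 2) := by
  -- Both choices of H need only invariance under the unipotent subgroup of GL_m, which for G
  -- consists of the triples (u, 1, 1).
  have key : ∀ f ∈ singIdeal n m,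
      (∀ u : GL (Fin m) ℂ, IsUpperUnipotent u → tensorSubst (u, 1, 1) f = f) →
      (∃ h ∈ singIdeal n (n ^ 2), tensorIncl n hm.le h = f) ∧
        ∀ p ∈ f.vars, (p.1 : ℕ) < n ^ 2 := by
    intro f hf hu
    have h := tensorIncl_restrictVars_eq_self hm.le hu
    refine ⟨⟨_, restrictVars_mem_singIdeal hm.le hf, h⟩, ?_⟩
    rw [← h]
    exact vars_tensorIncl_lt hm.le _
  refine ⟨fun V hirr hV => ⟨?_, fun f hf w₁ w₂ w₃ hw => ?_⟩,
    fun V hirr hV => ⟨?_, fun f hf w hw => ?_⟩⟩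
  · exact exists_isTensorHighestWeightVector V (toSubmodule_ne_bot_of_isIrreducible V hirr)
  · exact key f (hV f hf) fun u hu =>
      hw.unipotent u 1 1 hu isUpperUnipotent_one isUpperUnipotent_one
  · exact exists_isHighestWeightVector V (toSubmodule_ne_bot_of_isIrreducible V hirr)
  · exact key f (hV f hf) fun u hu => hw.unipotent u hu
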